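/- Let $\zeta$ be a real transcendental number. For an integer $n\geq 1$ let $\widehat{\lambda}_{n}(\zeta)$ be the supremum of the real numbers $\eta$ such that for all sufficiently large real $X$ there is a nonzero integer vector $(x,y_1,\ldots,y_n)\in\mathbb{Z}^{n+1}$ with $$|x|\leq X,\qquad \max_{1\leq i\leq n}|\zeta^{i}x-y_i|\leq X^{-\eta},$$ and let $\widehat{w}_{n}(\zeta)$ be the supremum of the real numbers $\eta$ such that for all sufficiently large real $X$ there is a polynomial $P\in\mathbb{Z}[T]$ of degree at most $n$, all of whose coefficients have absolute value at most $X$, with $0<|P(\zeta)|\leq X^{-\eta}$. Then for every integer $n\geq 2$ $$\widehat{\lambda}_{2n-1}(\zeta)\leq\frac{1-\widehat{\lambda}_{n}(\zeta)}{n-1};$$ in particular $\widehat{\lambda}_{2}(\zeta)+\widehat{\lambda}_{3}(\zeta)\leq 1$. Moreover, for every integer $n\geq 2$ with $\widehat{w}_{n}(\zeta)>2n-2$, $$\widehat{w}_{2n-1}(\zeta)\leq\frac{\widehat{w}_{n}(\zeta)}{\widehat{w}_{n}(\zeta)-2n+2}.$$ -/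

import Mathlib

open Polynomial

noncomputable section

/-- The system `|x| ≤ X`, `max_{1 ≤ i ≤ n} |ζ ^ i * x - y_i| ≤ X ^ (-η)` has a nonzero solution
`(x, y_1, …, y_n)` in integers (the coordinate `y_i` is stored at the index `i - 1`). -/
def SimulSolvable (n : ℕ) (ζ η X : ℝ) : Prop :=
  ∃ (x : ℤ) (y : Fin n → ℤ), (x, y) ≠ 0 ∧ |(x : ℝ)| ≤ X ∧
    ∀ i : Fin n, |ζ ^ ((i : ℕ) + 1) * (x : ℝ) - (y i : ℝ)| ≤ X ^ (-η)

/-- The uniform exponent of simultaneous rational approximation to `(ζ, ζ ^ 2, …, ζ ^ n)`: the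
supremum, in the extended reals, of the real `η` such that the system is nontrivially solvable
for all sufficiently large real `X`. -/
def lambdaHat (n : ℕ) (ζ : ℝ) : EReal :=
  sSup ((fun η : ℝ => (η : EReal)) ''
    {η : ℝ | ∃ X₀ : ℝ, ∀ X : ℝ, X₀ ≤ X → SimulSolvable n ζ η X})

/-- There is an integer polynomial `P` of degree at most `n` whose height (the largest absolute
value of its coefficients) is at most `X` and which satisfies `0 < |P(ζ)| ≤ X ^ (-η)`. -/
def PolySolvable (n : ℕ) (ζ η X : ℝ) : Prop :=
  ∃ P : ℤ[X], P.natDegree ≤ n ∧ (∀ i : ℕ, |(P.coeff i : ℝ)| ≤ X) ∧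
    0 < |aeval ζ P| ∧ |aeval ζ P| ≤ X ^ (-η)

/-- The uniform exponent of polynomial approximation: the supremum, in the extended reals, of the
real `η` such that for all sufficiently large real `X` there is a polynomial as in
`PolySolvable`. -/
def wHat (n : ℕ) (ζ : ℝ) : EReal :=
  sSup ((fun η : ℝ => (η : EReal)) ''
    {η : ℝ | ∃ X₀ : ℝ, ∀ X : ℝ, X₀ ≤ X → PolySolvable n ζ η X})

end

/-! Both inequalities follow by inserting an intermediate bound, essentially `λ̂_{2n-1} * ŵ_n ≤ 1`,
between German's two transference inequalities.

The intermediate bound is `simulExponent_mul_polyExponent_le_one`. Multiplicativity of the Mahler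
measure yields irreducible `R` of degree at most `n`, of arbitrarily large measure `M`, with
`|R(ζ)|` nearly as small as `ŵ_n` allows. A second small-valued polynomial `Q` of height at most a
small multiple of `M` cannot be divisible by `R`, so the two are coprime, and their shifts span all
polynomials of degree at most `2n-1`. A very good simultaneous approximation to `ζ, …, ζ^(2n-1)`
pairs with each shift to an integer of absolute value below 1, hence to 0, and is therefore the zero
vector.

German's inequalities are `ŵ_n ≥ (n-1)/(1-λ̂_n)` and `λ̂_m ≥ (1-1/ŵ_m)/(m-1)`. They come from
`exists_int_vec_transfer`: two consecutive minimal points of one problem are made orthogonal to a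
point of the dual problem by Minkowski's theorem. The first, in dimension `n`, bounds `λ̂_{2n-1}` by
`1/ŵ_n ≤ (1-λ̂_n)/(n-1)`. The second, with `m = 2n-1`, gives `(1-1/ŵ_{2n-1})/(2n-2) ≤ 1/ŵ_n`, which
is solved for `ŵ_{2n-1}`. -/

open MeasureTheory Matrix in
/-- Minkowski's linear forms theorem. -/
theorem exists_int_vec_abs_mulVec_lt {ι : Type*} [Fintype ι] [DecidableEq ι]
    (N : Matrix ι ι ℝ) (hN : N.det ≠ 0) (c : ι → ℝ) (hc : ∀ i, 0 < c i)
    (h : |N.det| < ∏ i, c i) :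
    ∃ v : ι → ℤ, v ≠ 0 ∧ ∀ i, |(N *ᵥ fun k => (v k : ℝ)) i| < c i := by
  classical
  let b := Pi.basisFun ℝ ι
  have fund := ZSpan.isAddFundamentalDomain' b volume
  have : Countable (Submodule.span ℤ (Set.range b)).toAddSubgroup := by
    change Countable (Submodule.span ℤ (Set.range b))
    infer_instance
  let box : Set (ι → ℝ) := Set.pi Set.univ fun i => Set.Ioo (-c i) (c i)
  have hmem : ∀ x : ι → ℝ, x ∈ (toLin' N) ⁻¹' box ↔ ∀ i, |(N *ᵥ x) i| < c i := by
    intro x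
    simp [box, abs_lt]
  have hconv : Convex ℝ ((toLin' N) ⁻¹' box) :=
    (convex_pi fun i _ => convex_Ioo _ _).linear_preimage (toLin' N)
  have hvol : volume (ZSpan.fundamentalDomain b) * 2 ^ Module.finrank ℝ (ι → ℝ)
      < volume ((toLin' N) ⁻¹' box) := by
    rw [Measure.addHaar_preimage_linearMap volume (by simpa using hN), Real.volume_pi_Ioo,
      ZSpan.fundamentalDomain_pi_basisFun, Real.volume_pi_Ico, LinearMap.det_toLin']
    rw [← ENNReal.ofReal_prod_of_nonneg (f := fun i => c i - -c i)
      (fun i _ => by linarith [hc i]), ← ENNReal.ofReal_mul (abs_nonneg _)]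
    have h2 : ∏ i, (c i - -c i) = 2 ^ Fintype.card ι * ∏ i, c i := by
      rw [Finset.prod_congr rfl (fun i _ => show c i - -c i = 2 * c i by ring),
        Finset.prod_mul_distrib]
      simp
    have h3 : (1 : ℝ) < |N.det⁻¹| * ∏ i, c i := by
      rw [abs_inv, inv_mul_eq_div, one_lt_div (abs_pos.mpr hN)]
      exact h
    simp only [sub_zero, ENNReal.ofReal_one, Finset.prod_const_one, one_mul,
      Module.finrank_fintype_fun_eq_card]
    rw [h2, show (2 : ENNReal) ^ Fintype.card ι = ENNReal.ofReal (2 ^ Fintype.card ι) by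
      rw [ENNReal.ofReal_pow (by norm_num)]; simp]
    rw [ENNReal.ofReal_lt_ofReal_iff_of_nonneg (by positivity)]
    have : (0 : ℝ) < 2 ^ Fintype.card ι := by positivity
    nlinarith
  obtain ⟨⟨x, hx⟩, hne, hxs⟩ := exists_ne_zero_mem_lattice_of_measure_mul_two_pow_lt_measure
    fund (fun x hx => by
      rw [hmem] at hx ⊢
      intro i
      rw [mulVec_neg, Pi.neg_apply, abs_neg]
      exact hx i) hconv hvol
  have hx' := (b.mem_span_iff_repr_mem ℤ x).mp hx
  choose v hv using hx'
  have hvx : (fun k => (v k : ℝ)) = x := by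
    ext k
    simpa [b] using hv k
  refine ⟨v, ?_, ?_⟩
  · rintro rfl
    apply hne
    ext k
    simp [← hvx]
  · rw [hvx]
    exact (hmem x).mp hxs

open Matrix

/-! ### Transference between a unimodular lattice and its dual -/

section Transference

variable {n : ℕ}

theorem det_updateRow_one (j : Fin (n + 1)) (u : Fin (n + 1) → ℝ) :
    ((1 : Matrix (Fin (n + 1)) (Fin (n + 1)) ℝ).updateRow j u).det = u j := by
  rw [← cramer_transpose_apply]
  simp

theorem updateRow_one_mulVec (j i : Fin (n + 1)) (u x : Fin (n + 1) → ℝ) :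
    ((1 : Matrix (Fin (n + 1)) (Fin (n + 1)) ℝ).updateRow j u *ᵥ x) i =
      if i = j then u ⬝ᵥ x else x i := by
  split_ifs with h
  · subst h
    simp [mulVec]
  · rw [mulVec, updateRow_ne h]
    change ((1 : Matrix (Fin (n + 1)) (Fin (n + 1)) ℝ) *ᵥ x) i = x i
    rw [one_mulVec]

/-- A vector pairs to integers with all vectors of the lattice spanned by the columns of `M`. -/
def DualIntegral (M : Matrix (Fin (n + 1)) (Fin (n + 1)) ℝ) (u : Fin (n + 1) → ℝ) : Prop :=
  ∀ v : Fin (n + 1) → ℤ, ∃ k : ℤ, u ⬝ᵥ (M *ᵥ fun i => (v i : ℝ)) = k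

theorem DualIntegral.eq_zero_of_abs_lt {M : Matrix (Fin (n + 1)) (Fin (n + 1)) ℝ}
    {u : Fin (n + 1) → ℝ} (hu : DualIntegral M u) {v : Fin (n + 1) → ℤ}
    (h : |u ⬝ᵥ (M *ᵥ fun i => (v i : ℝ))| < 1) : u ⬝ᵥ (M *ᵥ fun i => (v i : ℝ)) = 0 := by
  obtain ⟨k, hk⟩ := hu v
  rw [hk] at h ⊢
  have : |k| < 1 := by exact_mod_cast h
  simp [Int.abs_lt_one_iff.mp this]

theorem abs_sum_le_card_mul {f : Fin n → ℝ} {B : ℝ} (h : ∀ i, |f i| ≤ B) :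
    |∑ i, f i| ≤ n * B := by
  calc |∑ i, f i| ≤ ∑ i, |f i| := Finset.abs_sum_le_sum_abs _ _
    _ ≤ ∑ _i : Fin n, B := Finset.sum_le_sum fun i _ => h i
    _ = n * B := by simp

/-- If a linear form vanishes and its `j`-th coefficient is dominant, then the `j`-th variable is
bounded in terms of the others. -/
theorem abs_le_of_sum_eq {a x : Fin n → ℝ} {j : Fin n} {B t : ℝ}
    (ha : ∀ i, |a i| ≤ |a j|) (hj : a j ≠ 0) (hx : ∀ i, i ≠ j → |x i| ≤ B)
    (ht : |t| ≤ |a j| * B) (h : t + ∑ i, a i * x i = 0) : |x j| ≤ n * B := by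
  have h1 : |a j * x j| ≤ n * (|a j| * B) := by
    have h2 : a j * x j = ∑ i, if i = j then -t else -(a i * x i) := by
      rw [← Finset.add_sum_erase _ _ (Finset.mem_univ j)] at h ⊢
      rw [if_pos rfl, Finset.sum_congr rfl (fun i hi => if_neg (Finset.ne_of_mem_erase hi)),
        Finset.sum_neg_distrib]
      linarith
    rw [h2]
    apply abs_sum_le_card_mul
    intro i
    split_ifs with hi
    · simpa using ht
    · rw [abs_neg, abs_mul]
      exact mul_le_mul (ha i) (hx i hi) (abs_nonneg _) (abs_nonneg _)
  rw [abs_mul] at h1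
  have := abs_pos.mpr hj
  nlinarith

/-- Minkowski is applied with the form `u` in place of coordinate `j.succ`, at the cost of
determinant `u j.succ`. Orthogonality to `u` then recovers the lost coordinate, because its
coefficient dominates; `h0` makes the contribution of coordinate 0 harmless. -/
theorem exists_int_vec_single {M : Matrix (Fin (n + 1)) (Fin (n + 1)) ℝ} (hM : |M.det| = 1)
    {u : Fin (n + 1) → ℝ} (hu : DualIntegral M u) {A B : ℝ} (hA : 0 < A) (hB : 0 < B)
    {j : Fin n} (hj : ∀ i : Fin n, |u i.succ| ≤ |u j.succ|) (hj0 : u j.succ ≠ 0)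
    (h0 : |u 0| * A ≤ |u j.succ| * B) (h1 : |u j.succ| < A * B ^ (n - 1)) :
    ∃ v : Fin (n + 1) → ℤ, v ≠ 0 ∧ |(M *ᵥ fun k => (v k : ℝ)) 0| ≤ A ∧
      ∀ i : Fin n, |(M *ᵥ fun k => (v k : ℝ)) i.succ| ≤ n * B := by
  obtain ⟨v, hv0, hv⟩ := exists_int_vec_abs_mulVec_lt
    ((1 : Matrix (Fin (n + 1)) (Fin (n + 1)) ℝ).updateRow j.succ u * M)
    (by
      rw [det_mul, det_updateRow_one]
      refine mul_ne_zero hj0 ?_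
      intro h
      simp [h] at hM)
    -- Bound 1 on the row carrying `u`: the pairing is an integer, so it vanishes.
    (Fin.cons A (fun i => if i = j then 1 else B))
    (by
      refine Fin.cases (by simpa using hA) fun i => ?_
      simp only [Fin.cons_succ]
      split_ifs <;> positivity)
    (by
      rw [det_mul, det_updateRow_one, abs_mul, hM, mul_one, Fin.prod_univ_succ]
      simp only [Fin.cons_zero, Fin.cons_succ]
      rw [Finset.prod_ite]
      simp only [Finset.prod_const_one, one_mul, Finset.prod_const]
      rw [Finset.filter_ne' _ j, Finset.card_erase_of_mem (Finset.mem_univ j)]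
      simpa using h1)
  simp only [← mulVec_mulVec, updateRow_one_mulVec] at hv
  have hu0 : u ⬝ᵥ (M *ᵥ fun k => (v k : ℝ)) = 0 :=
    hu.eq_zero_of_abs_lt (by simpa using hv j.succ)
  have hv0' : |(M *ᵥ fun k => (v k : ℝ)) 0| ≤ A := by
    have := hv 0
    rw [if_neg (Fin.succ_ne_zero j).symm] at this
    simpa using this.le
  have hvi : ∀ i, i ≠ j → |(M *ᵥ fun k => (v k : ℝ)) i.succ| ≤ B := by
    intro i hi
    have := hv i.succ
    rw [if_neg (by simpa using hi)] at this
    simpa [hi] using this.le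
  have hn : (1 : ℝ) ≤ n := by
    have : 0 < n := j.pos
    exact_mod_cast this
  refine ⟨v, hv0, hv0', fun i => ?_⟩
  by_cases hi : i = j
  · subst hi
    rw [dotProduct, Fin.sum_univ_succ] at hu0
    refine abs_le_of_sum_eq (a := fun k => u k.succ)
      (x := fun k => (M *ᵥ fun k => (v k : ℝ)) k.succ) hj hj0 hvi ?_ hu0
    rw [abs_mul]
    exact (mul_le_mul_of_nonneg_left hv0' (abs_nonneg _)).trans h0
  · have := hvi i hi
    nlinarith

/-- Here both `u` and `w` replace coordinates, namely 0 and `j.succ`, so the determinant is a 2×2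
minor. Eliminating coordinate 0 from the two orthogonality relations leaves a relation whose
coefficients are the minors, the largest at `j`; this bounds coordinate `j.succ`. The relation with
`u` and `h0` then bound coordinate 0. -/
theorem exists_int_vec_double {M : Matrix (Fin (n + 1)) (Fin (n + 1)) ℝ} (hM : |M.det| = 1)
    {u w : Fin (n + 1) → ℝ} (hu : DualIntegral M u) (hw : DualIntegral M w) {A B : ℝ}
    (hB : 0 < B) (hu0 : u 0 ≠ 0)
    {j : Fin n}
    (hj : ∀ i : Fin n, |u 0 * w i.succ - w 0 * u i.succ| ≤ |u 0 * w j.succ - w 0 * u j.succ|)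
    (hj0 : u 0 * w j.succ - w 0 * u j.succ ≠ 0)
    (h0 : ∀ i : Fin n, |u i.succ| * B ≤ |u 0| * A)
    (h1 : |u 0 * w j.succ - w 0 * u j.succ| < B ^ (n - 1)) :
    ∃ v : Fin (n + 1) → ℤ, v ≠ 0 ∧ |(M *ᵥ fun k => (v k : ℝ)) 0| ≤ n ^ 2 * A ∧
      ∀ i : Fin n, |(M *ᵥ fun k => (v k : ℝ)) i.succ| ≤ n * B := by
  -- The form `w` expressed in the coordinates where `u ⬝ᵥ x` has replaced `x 0`.
  let w' : Fin (n + 1) → ℝ :=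
    Fin.cons (w 0 / u 0) fun i => (u 0 * w i.succ - w 0 * u i.succ) / u 0
  have hw'0 : ∀ x : Fin (n + 1) → ℝ, w' ⬝ᵥ (Function.update x 0 (u ⬝ᵥ x)) = w ⬝ᵥ x := by
    intro x
    rw [dotProduct, dotProduct, Fin.sum_univ_succ, dotProduct, Fin.sum_univ_succ (n := n),
      Fin.sum_univ_succ (n := n)]
    simp only [w', Fin.cons_zero, Fin.cons_succ, Function.update_self]
    rw [mul_add, Finset.mul_sum, add_assoc, ← Finset.sum_add_distrib]
    congr 1
    · field_simp
    · refine Finset.sum_congr rfl fun i _ => ?_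
      rw [Function.update_of_ne (Fin.succ_ne_zero i)]
      field_simp
      ring
  have hmv : ∀ x : Fin (n + 1) → ℝ,
      (1 : Matrix (Fin (n + 1)) (Fin (n + 1)) ℝ).updateRow 0 u *ᵥ x =
        Function.update x 0 (u ⬝ᵥ x) := by
    intro x
    ext i
    rw [updateRow_one_mulVec, Function.update_apply]
  have hdet : ((1 : Matrix (Fin (n + 1)) (Fin (n + 1)) ℝ).updateRow j.succ w' *
      ((1 : Matrix (Fin (n + 1)) (Fin (n + 1)) ℝ).updateRow 0 u * M)).det =
      (u 0 * w j.succ - w 0 * u j.succ) * M.det := by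
    rw [det_mul, det_mul, det_updateRow_one, det_updateRow_one]
    simp only [w', Fin.cons_succ]
    field_simp
  obtain ⟨v, hv0, hv⟩ := exists_int_vec_abs_mulVec_lt
    ((1 : Matrix (Fin (n + 1)) (Fin (n + 1)) ℝ).updateRow j.succ w' *
      ((1 : Matrix (Fin (n + 1)) (Fin (n + 1)) ℝ).updateRow 0 u * M))
    (by
      rw [hdet]
      refine mul_ne_zero hj0 ?_
      intro h
      simp [h] at hM)
    (Fin.cons 1 (fun i => if i = j then 1 else B))
    (by
      refine Fin.cases (by simp) fun i => ?_
      simp only [Fin.cons_succ]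
      split_ifs <;> positivity)
    (by
      rw [hdet, abs_mul, hM, mul_one, Fin.prod_univ_succ]
      simp only [Fin.cons_zero, Fin.cons_succ]
      rw [Finset.prod_ite]
      simp only [Finset.prod_const_one, one_mul, Finset.prod_const]
      rw [Finset.filter_ne' _ j, Finset.card_erase_of_mem (Finset.mem_univ j)]
      simpa using h1)
  simp only [← mulVec_mulVec, updateRow_one_mulVec, hmv, hw'0] at hv
  have huv : u ⬝ᵥ (M *ᵥ fun k => (v k : ℝ)) = 0 := by
    apply hu.eq_zero_of_abs_lt
    have := hv 0
    rw [if_neg (Fin.succ_ne_zero j).symm] at this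
    simpa using this
  have hwv : w ⬝ᵥ (M *ᵥ fun k => (v k : ℝ)) = 0 :=
    hw.eq_zero_of_abs_lt (by simpa using hv j.succ)
  have hvi : ∀ i, i ≠ j → |(M *ᵥ fun k => (v k : ℝ)) i.succ| ≤ B := by
    intro i hi
    have := hv i.succ
    rw [if_neg (by simpa using hi), Function.update_of_ne (Fin.succ_ne_zero i)] at this
    simpa [hi] using this.le
  have hn : (1 : ℝ) ≤ n := by
    have : 0 < n := j.pos
    exact_mod_cast this
  rw [dotProduct, Fin.sum_univ_succ] at huv hwv
  have hvi' : ∀ i : Fin n, |(M *ᵥ fun k => (v k : ℝ)) i.succ| ≤ n * B := by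
    intro i
    by_cases hi : i = j
    · subst hi
      refine abs_le_of_sum_eq (a := fun k => u 0 * w k.succ - w 0 * u k.succ) (t := 0)
        (x := fun k => (M *ᵥ fun k => (v k : ℝ)) k.succ) hj hj0 hvi
        (by simp; positivity) ?_
      simp only [sub_mul, Finset.sum_sub_distrib, mul_assoc, ← Finset.mul_sum]
      linear_combination u 0 * hwv - w 0 * huv
    · have := hvi i hi
      nlinarith
  refine ⟨v, hv0, ?_, hvi'⟩
  have h2 : |u 0 * (M *ᵥ fun k => (v k : ℝ)) 0| ≤ n * (n * (|u 0| * A)) := by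
    rw [eq_neg_of_add_eq_zero_left huv, abs_neg]
    apply abs_sum_le_card_mul
    intro i
    rw [abs_mul]
    calc _ ≤ |u i.succ| * (n * B) := mul_le_mul_of_nonneg_left (hvi' i) (abs_nonneg _)
      _ = n * (|u i.succ| * B) := by ring
      _ ≤ _ := mul_le_mul_of_nonneg_left (h0 i) (by positivity)
  rw [abs_mul] at h2
  have := abs_pos.mpr hu0
  rw [show (n : ℝ) * (n * (|u 0| * A)) = |u 0| * (n ^ 2 * A) by ring] at h2
  exact le_of_mul_le_mul_left h2 this

/-- The transference principle behind German's inequalities. -/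
theorem exists_int_vec_transfer (hn : 0 < n) {M : Matrix (Fin (n + 1)) (Fin (n + 1)) ℝ}
    (hM : |M.det| = 1) {u w : Fin (n + 1) → ℝ} (hu : DualIntegral M u) (hw : DualIntegral M w)
    {A B : ℝ} (hA : 0 < A) (hB : 0 < B) (hu0 : u 0 ≠ 0)
    (huw : ∃ i : Fin n, u 0 * w i.succ - w 0 * u i.succ ≠ 0)
    (h1 : ∀ i : Fin n, |u i.succ| < A * B ^ (n - 1))
    (h2 : ∀ i : Fin n, |u 0 * w i.succ - w 0 * u i.succ| < B ^ (n - 1)) :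
    ∃ v : Fin (n + 1) → ℤ, v ≠ 0 ∧ |(M *ᵥ fun k => (v k : ℝ)) 0| ≤ n ^ 2 * A ∧
      ∀ i : Fin n, |(M *ᵥ fun k => (v k : ℝ)) i.succ| ≤ n * B := by
  have : Nonempty (Fin n) := ⟨⟨0, hn⟩⟩
  have hn1 : (1 : ℝ) ≤ n := by exact_mod_cast hn
  obtain ⟨j, hj⟩ := Finite.exists_max fun i : Fin n => |u i.succ|
  -- Relative to the box, either a coordinate `j.succ` of `u` dominates and `u` alone suffices, or
  -- coordinate 0 does and `w` is needed as well.
  by_cases h0 : |u 0| * A ≤ |u j.succ| * B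
  · have hj0 : u j.succ ≠ 0 := by
      intro h
      rw [h, abs_zero, zero_mul] at h0
      have := mul_pos (abs_pos.mpr hu0) hA
      linarith
    obtain ⟨v, hv, hv0, hvi⟩ := exists_int_vec_single hM hu hA hB hj hj0 h0 (h1 j)
    exact ⟨v, hv, hv0.trans (le_mul_of_one_le_left hA.le (one_le_pow₀ hn1)), hvi⟩
  · obtain ⟨l, hl⟩ := Finite.exists_max fun i : Fin n => |u 0 * w i.succ - w 0 * u i.succ|
    obtain ⟨i, hi⟩ := huw
    refine exists_int_vec_double hM hu hw hB hu0 hl ?_ (fun i => ?_) (h2 l)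
    · exact abs_pos.mp ((abs_pos.mpr hi).trans_le (hl i))
    · exact (mul_le_mul_of_nonneg_right (hj i) hB.le).trans (not_le.mp h0).le

end Transference

open Filter Topology

/-! ### Irreducible polynomials with small values, via the Mahler measure -/

section Mahler

variable {ζ : ℝ}

theorem aeval_ne_zero_of_transcendental (hζ : Transcendental ℚ ζ) {P : ℤ[X]} (hP : P ≠ 0) :
    aeval ζ P ≠ 0 := fun h =>
  hζ ((IsFractionRing.isAlgebraic_iff ℤ ℚ ℝ).mp ⟨P, hP, h⟩)

theorem mahlerMeasure_le_of_abs_coeff_le {n : ℕ} {P : ℤ[X]} (hn : P.natDegree ≤ n) {h : ℝ}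
    (hh : ∀ i, |(P.coeff i : ℝ)| ≤ h) :
    (P.map (Int.castRingHom ℂ)).mahlerMeasure ≤ (n + 1) * h := by
  refine (mahlerMeasure_le_sum_norm_coeff _).trans ?_
  rw [sum_over_range' _ (by simp) (n + 1)
    (Nat.lt_succ_of_le ((natDegree_map_le).trans hn))]
  calc _ ≤ ∑ i ∈ Finset.range (n + 1), h := by
        refine Finset.sum_le_sum fun i _ => ?_
        simpa using hh i
    _ = _ := by simp

theorem abs_coeff_le_two_pow_mul_mahlerMeasure {n : ℕ} {P : ℤ[X]} (hn : P.natDegree ≤ n)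
    (i : ℕ) : |(P.coeff i : ℝ)| ≤ 2 ^ n * (P.map (Int.castRingHom ℂ)).mahlerMeasure := by
  have h := norm_coeff_le_choose_mul_mahlerMeasure i (P.map (Int.castRingHom ℂ))
  have h2 : ((P.map (Int.castRingHom ℂ)).natDegree.choose i : ℝ) ≤ 2 ^ n := by
    have h3 : (P.map (Int.castRingHom ℂ)).natDegree ≤ n := natDegree_map_le.trans hn
    have := (Nat.choose_le_two_pow (P.map (Int.castRingHom ℂ)).natDegree i).trans
      (Nat.pow_le_pow_right (by norm_num) h3)
    exact_mod_cast this
  calc |(P.coeff i : ℝ)| = ‖(P.map (Int.castRingHom ℂ)).coeff i‖ := by simp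
    _ ≤ _ := h
    _ ≤ _ := mul_le_mul_of_nonneg_right h2 (mahlerMeasure_nonneg _)

/-- If every irreducible polynomial of large Mahler measure takes a value at `ζ` that is not too
small, then so does every nonzero polynomial of bounded degree. -/
theorem exists_mul_rpow_le_abs_aeval (hζ : Transcendental ℚ ζ) {n : ℕ} {w K : ℝ} (hw : 0 ≤ w)
    (h : ∀ R : ℤ[X], Irreducible R → R.natDegree ≤ n →
      K < (R.map (Int.castRingHom ℂ)).mahlerMeasure →
      (R.map (Int.castRingHom ℂ)).mahlerMeasure ^ (-w) ≤ |aeval ζ R|) :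
    ∃ c : ℝ, 0 < c ∧ ∀ P : ℤ[X], P ≠ 0 → P.natDegree ≤ n →
      c * (P.map (Int.castRingHom ℂ)).mahlerMeasure ^ (-w) ≤ |aeval ζ P| := by
  -- Northcott: only finitely many polynomials escape `h` for having small measure, so their nonzero
  -- values share a positive lower bound `c`.
  have hfin := finite_mahlerMeasure_le n K.toNNReal
  have hev : ∀ᶠ c in 𝓝[>] (0 : ℝ), ∀ R ∈ {p : ℤ[X] | p.natDegree ≤ n ∧
      (p.map (Int.castRingHom ℂ)).mahlerMeasure ≤ K.toNNReal}, R ≠ 0 → c ≤ |aeval ζ R| := by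
    rw [eventually_all_finite hfin]
    intro R _
    by_cases hR : R = 0
    · simp [hR]
    · have := abs_pos.mpr (aeval_ne_zero_of_transcendental hζ hR)
      filter_upwards [nhdsWithin_le_nhds (eventually_le_nhds this)] with c hc _ using hc
  obtain ⟨c, hc, hc0, hc1⟩ := (hev.and (Ioc_mem_nhdsGT (zero_lt_one' ℝ))).exists
  -- Each nonconstant irreducible factor costs at most one factor `c`. The exponent `natDegree` is
  -- additive, which suits the induction on factors, and is at least the number of such factors.
  refine ⟨c ^ n, by positivity, ?_⟩
  have key : ∀ P : ℤ[X], P ≠ 0 → P.natDegree ≤ n →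
      c ^ P.natDegree * (P.map (Int.castRingHom ℂ)).mahlerMeasure ^ (-w) ≤ |aeval ζ P| := by
    have hconst : ∀ P : ℤ[X], P ≠ 0 → P.natDegree = 0 →
        c ^ P.natDegree * (P.map (Int.castRingHom ℂ)).mahlerMeasure ^ (-w) ≤ |aeval ζ P| := by
      intro P hP hd
      rw [hd, pow_zero, one_mul]
      obtain ⟨a, rfl⟩ := natDegree_eq_zero.mp hd
      have ha : a ≠ 0 := by rintro rfl; simp at hP
      refine (Real.rpow_le_one_of_one_le_of_nonpos (one_le_mahlerMeasure_of_ne_zero hP)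
        (by linarith)).trans ?_
      simpa using show (1 : ℝ) ≤ |(a : ℝ)| from by exact_mod_cast Int.one_le_abs ha
    intro P
    induction P using WfDvdMonoid.induction_on_irreducible with
    | zero => simp
    | unit u hu => exact fun h0 _ => hconst u h0 (natDegree_eq_zero_of_isUnit hu)
    | mul a R ha hR ih =>
      intro h0 hd
      have hdm := natDegree_mul hR.ne_zero ha
      have ih' := ih ha (by omega)
      have hRn : R.natDegree ≤ n := by omega
      have hR1 := one_le_mahlerMeasure_of_ne_zero hR.ne_zero
      have hRb : c ^ R.natDegree * (R.map (Int.castRingHom ℂ)).mahlerMeasure ^ (-w) ≤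
          |aeval ζ R| := by
        by_cases hR0 : R.natDegree = 0
        · exact hconst R hR.ne_zero hR0
        by_cases hK : K < (R.map (Int.castRingHom ℂ)).mahlerMeasure
        · refine le_trans ?_ (h R hR hRn hK)
          exact mul_le_of_le_one_left (by positivity) (pow_le_one₀ hc0.le hc1)
        · have h1 := hc R ⟨hRn, (not_lt.mp hK).trans (Real.le_coe_toNNReal K)⟩ hR.ne_zero
          refine le_trans ?_ h1
          calc _ ≤ c ^ R.natDegree * 1 := by
                refine mul_le_mul_of_nonneg_left ?_ (by positivity)
                exact Real.rpow_le_one_of_one_le_of_nonpos hR1 (by linarith)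
            _ ≤ c := by
                rw [mul_one]
                exact pow_le_of_le_one hc0.le hc1 hR0
      rw [hdm, Polynomial.map_mul, mahlerMeasure_mul,
        Real.mul_rpow (mahlerMeasure_nonneg _) (mahlerMeasure_nonneg _), map_mul, abs_mul, pow_add]
      calc _ = (c ^ R.natDegree * (R.map (Int.castRingHom ℂ)).mahlerMeasure ^ (-w)) *
            (c ^ a.natDegree * (a.map (Int.castRingHom ℂ)).mahlerMeasure ^ (-w)) := by ring
        _ ≤ _ := by
          refine mul_le_mul hRb ih' ?_ (abs_nonneg _)
          have := mahlerMeasure_nonneg (a.map (Int.castRingHom ℂ))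
          positivity
  intro P hP hd
  refine le_trans ?_ (key P hP hd)
  refine mul_le_mul_of_nonneg_right (pow_le_pow_of_le_one hc0.le hc1 hd) ?_
  exact Real.rpow_nonneg (mahlerMeasure_nonneg _) _

/-- If there were none, the preceding lower bound would hold for all nonzero polynomials of degree
at most `n`. The gap between `w'` and `w` absorbs both its constant and the comparison of height
with Mahler measure. -/
theorem exists_irreducible_abs_aeval_lt (hζ : Transcendental ℚ ζ) {n : ℕ} {w w' : ℝ}
    (hw' : 0 ≤ w') (hww : w' < w) (h : ∀ᶠ X in atTop, PolySolvable n ζ w X) (K : ℝ) :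
    ∃ R : ℤ[X], Irreducible R ∧ R.natDegree ≤ n ∧
      K < (R.map (Int.castRingHom ℂ)).mahlerMeasure ∧
      |aeval ζ R| < (R.map (Int.castRingHom ℂ)).mahlerMeasure ^ (-w') := by
  by_contra! hcon
  obtain ⟨c, hc, hcP⟩ := exists_mul_rpow_le_abs_aeval hζ hw' hcon
  have hlim := (tendsto_rpow_neg_atTop (sub_pos.mpr hww)).eventually_lt_const
    (show 0 < c * ((n : ℝ) + 1) ^ (-w') by positivity)
  obtain ⟨H, ⟨P, hPn, hPc, hP0, hPw⟩, hH, hH0⟩ := (h.and (hlim.and (eventually_gt_atTop 0))).exists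
  have hPne : P ≠ 0 := by rintro rfl; simp at hP0
  have h1 := hcP P hPne hPn
  have hM1 := one_le_mahlerMeasure_of_ne_zero hPne
  have h2 : (((n : ℝ) + 1) * H) ^ (-w') ≤ (P.map (Int.castRingHom ℂ)).mahlerMeasure ^ (-w') :=
    Real.rpow_le_rpow_of_nonpos (by linarith) (mahlerMeasure_le_of_abs_coeff_le hPn hPc)
      (by linarith)
  rw [Real.mul_rpow (by positivity) hH0.le] at h2
  have h3 : c * (((n : ℝ) + 1) ^ (-w') * H ^ (-w')) ≤ H ^ (-w) :=
    (mul_le_mul_of_nonneg_left h2 hc.le).trans (h1.trans hPw)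
  have h4 : H ^ (-w) = H ^ (-(w - w')) * H ^ (-w') := by
    rw [← Real.rpow_add hH0]
    ring_nf
  rw [h4, ← mul_assoc] at h3
  have := le_of_mul_le_mul_right h3 (by positivity)
  linarith

end Mahler

/-! ### Coprime polynomials as obstructions to simultaneous approximation -/

section Coprime

/-- A linear functional vanishing on all shifts, of degree at most `2 * n - 1`, of two coprime
polynomials of degree at most `n` vanishes on all polynomials of degree at most `2 * n - 1`. -/
theorem linearMap_eq_zero_of_isCoprime {k : Type*} [Field k] {n : ℕ} (hn : 1 ≤ n)
    (φ : k[X] →ₗ[k] k) {R Q : k[X]} (hR0 : R ≠ 0) (hR : R.natDegree ≤ n) (hQ : Q.natDegree ≤ n)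
    (hRQ : IsCoprime R Q)
    (hφR : ∀ i, i + R.natDegree ≤ 2 * n - 1 → φ (X ^ i * R) = 0)
    (hφQ : ∀ i, i + Q.natDegree ≤ 2 * n - 1 → φ (X ^ i * Q) = 0)
    {F : k[X]} (hF : F.natDegree ≤ 2 * n - 1) : φ F = 0 := by
  have key : ∀ P A : k[X], (∀ i, i + P.natDegree ≤ 2 * n - 1 → φ (X ^ i * P) = 0) →
      A.natDegree + P.natDegree ≤ 2 * n - 1 → φ (A * P) = 0 := by
    intro P A hP hA
    rw [A.as_sum_range_C_mul_X_pow, Finset.sum_mul, map_sum]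
    refine Finset.sum_eq_zero fun i hi => ?_
    rw [mul_assoc, ← smul_eq_C_mul, map_smul, hP i, smul_zero]
    have := Finset.mem_range_succ_iff.mp hi
    omega
  obtain ⟨a, b, hab⟩ := hRQ
  -- The cofactor of `Q` in the Bézout identity for `F` is reduced modulo `R`, so its degree is at
  -- most `n - 1`; the degree of the other cofactor is then forced.
  set B := (b * F) % R with hB
  set A := a * F + (b * F) / R * Q with hA
  have hFe : F = A * R + B * Q := by
    have h1 := EuclideanDomain.div_add_mod (b * F) R
    calc F = (a * R + b * Q) * F := by rw [hab, one_mul]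
      _ = a * F * R + (R * (b * F / R) + b * F % R) * Q := by rw [h1]; ring
      _ = _ := by rw [hA, hB]; ring
  have hBdeg : B.natDegree + Q.natDegree ≤ 2 * n - 1 := by
    have h1 : B.natDegree ≤ n - 1 := by
      by_cases hB0 : B = 0
      · simp [hB0]
      · have := natDegree_lt_natDegree hB0 (EuclideanDomain.mod_lt (b * F) hR0)
        omega
    omega
  have hAR : (A * R).natDegree ≤ 2 * n - 1 := by
    rw [show A * R = F - B * Q by rw [hFe]; ring]
    refine (natDegree_sub_le _ _).trans (max_le hF ?_)
    exact natDegree_mul_le.trans hBdeg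
  rw [hFe, map_add, key Q B hφQ hBdeg, add_zero]
  by_cases hA0 : A = 0
  · simp [hA0]
  · exact key R A hφR (by rwa [natDegree_mul hA0 hR0] at hAR)

theorem isCoprime_map_of_irreducible {R Q : ℤ[X]} (hR : Irreducible R) (hd : R.natDegree ≠ 0)
    (hRQ : ¬ R ∣ Q) :
    IsCoprime (R.map (Int.castRingHom ℚ)) (Q.map (Int.castRingHom ℚ)) := by
  have hprim := hR.isPrimitive hd
  have hirr := (IsPrimitive.Int.irreducible_iff_irreducible_map_cast hprim).mp hR
  rw [hirr.coprime_iff_not_dvd]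
  rwa [← IsPrimitive.Int.dvd_iff_map_cast_dvd_map_cast _ _ hprim]

/-- The pairing equals `z 0 * F(ζ)` minus the coefficients of `F` paired with the approximation
errors. -/
theorem abs_sum_coeff_mul_le {ζ : ℝ} {m : ℕ} {F : ℤ[X]} (hF : F.natDegree ≤ m) {h δ : ℝ}
    (hh : ∀ i, |(F.coeff i : ℝ)| ≤ h) {z : ℕ → ℤ}
    (hz : ∀ i ≤ m, |ζ ^ i * (z 0 : ℝ) - z i| ≤ δ) :
    |((∑ i ∈ Finset.range (m + 1), F.coeff i * z i : ℤ) : ℝ)| ≤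
      |(z 0 : ℝ)| * |aeval ζ F| + (m + 1) * (h * δ) := by
  have h1 : ((∑ i ∈ Finset.range (m + 1), F.coeff i * z i : ℤ) : ℝ) =
      z 0 * aeval ζ F - ∑ i ∈ Finset.range (m + 1), F.coeff i * (ζ ^ i * (z 0 : ℝ) - z i) := by
    rw [aeval_eq_sum_range' (Nat.lt_succ_of_le hF), Finset.mul_sum, ← Finset.sum_sub_distrib]
    push_cast
    refine Finset.sum_congr rfl fun i _ => ?_
    simp only [zsmul_eq_mul]
    ring
  rw [h1, ← abs_mul]
  refine (abs_sub _ _).trans (add_le_add le_rfl ?_)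
  calc _ ≤ ∑ i ∈ Finset.range (m + 1), |F.coeff i * (ζ ^ i * (z 0 : ℝ) - z i)| :=
        Finset.abs_sum_le_sum_abs _ _
    _ ≤ ∑ i ∈ Finset.range (m + 1), h * δ := by
        refine Finset.sum_le_sum fun i hi => ?_
        rw [abs_mul]
        exact mul_le_mul (hh i) (hz i (Finset.mem_range_succ_iff.mp hi)) (abs_nonneg _)
          ((abs_nonneg _).trans (hh i))
    _ = _ := by simp

theorem sum_coeff_X_pow_mul_eq_zero {ζ : ℝ} {m : ℕ} {P : ℤ[X]} {h δ ε X₀ : ℝ}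
    (hh : ∀ i, |(P.coeff i : ℝ)| ≤ h) (hε : |aeval ζ P| ≤ ε) {z : ℕ → ℤ}
    (hz0 : |(z 0 : ℝ)| ≤ X₀) (hz : ∀ i ≤ m, |ζ ^ i * (z 0 : ℝ) - z i| ≤ δ)
    (hsmall : X₀ * (max 1 |ζ| ^ m * ε) + (m + 1) * (h * δ) < 1) (i : ℕ)
    (hi : i + P.natDegree ≤ m) :
    ∑ j ∈ Finset.range (m + 1), (X ^ i * P).coeff j * z j = 0 := by
  have hd : (X ^ i * P).natDegree ≤ m := natDegree_mul_le.trans (by simpa using hi)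
  have h0 : 0 ≤ h := (abs_nonneg _).trans (hh 0)
  have hb := abs_sum_coeff_mul_le (ζ := ζ) hd (h := h) (fun j => by
    rw [coeff_X_pow_mul']
    split_ifs
    · exact hh _
    · simpa using h0) hz
  have hv : |aeval ζ (X ^ i * P)| ≤ max 1 |ζ| ^ m * ε := by
    rw [map_mul, map_pow, aeval_X, abs_mul, abs_pow]
    refine mul_le_mul ?_ hε (abs_nonneg _) (by positivity)
    calc |ζ| ^ i ≤ max 1 |ζ| ^ i := pow_le_pow_left₀ (abs_nonneg _) (le_max_right _ _) _
      _ ≤ _ := pow_le_pow_right₀ (le_max_left _ _) (by omega)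
  have hlt := (hb.trans (add_le_add
    (mul_le_mul hz0 hv (abs_nonneg _) ((abs_nonneg _).trans hz0)) le_rfl)).trans_lt hsmall
  rw [← Int.abs_lt_one_iff]
  exact_mod_cast hlt

/-- Two coprime polynomials of degree at most `n` with small values obstruct simultaneous
approximation to the first `2 * n - 1` powers. -/
theorem SimulSolvable.one_le {n : ℕ} (hn : 1 ≤ n) {ζ η X₀ h ε : ℝ}
    (hs : SimulSolvable (2 * n - 1) ζ η X₀) {R Q : ℤ[X]} (hR0 : R ≠ 0)
    (hR : R.natDegree ≤ n) (hQ : Q.natDegree ≤ n)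
    (hRQ : IsCoprime (R.map (Int.castRingHom ℚ)) (Q.map (Int.castRingHom ℚ)))
    (hRh : ∀ i, |(R.coeff i : ℝ)| ≤ h) (hQh : ∀ i, |(Q.coeff i : ℝ)| ≤ h)
    (hRε : |aeval ζ R| ≤ ε) (hQε : |aeval ζ Q| ≤ ε) :
    1 ≤ X₀ * (max 1 |ζ| ^ (2 * n - 1) * ε) + ((2 * n - 1 : ℕ) + 1) * (h * X₀ ^ (-η)) := by
  by_contra! hcon
  set m := 2 * n - 1 with hm
  obtain ⟨x, y, hne, hx, hy⟩ := hs
  have hX0 : 0 ≤ X₀ := (abs_nonneg _).trans hx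
  obtain ⟨z, hzx, hzy⟩ : ∃ z : ℕ → ℤ, z 0 = x ∧ ∀ i : Fin m, z (i + 1) = y i :=
    ⟨fun i => Nat.casesOn i x fun k => if hk : k < m then y ⟨k, hk⟩ else 0, rfl,
      fun i => dif_pos i.2⟩
  have hz : ∀ i ≤ m, |ζ ^ i * (z 0 : ℝ) - z i| ≤ X₀ ^ (-η) := by
    intro i hi
    cases i with
    | zero => simpa using Real.rpow_nonneg hX0 _
    | succ k =>
      have := hy ⟨k, hi⟩
      rwa [← hzy, ← hzx] at this
  -- The functional sending `X ^ i` to `z i`; it kills all admissible shifts of `R` and `Q`, hence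
  -- every `X ^ i` with `i ≤ m`.
  let φ : ℚ[X] →ₗ[ℚ] ℚ := ∑ i ∈ Finset.range (m + 1), (z i : ℚ) • lcoeff ℚ i
  have hφ : ∀ F : ℤ[X], φ (F.map (Int.castRingHom ℚ)) =
      ((∑ i ∈ Finset.range (m + 1), F.coeff i * z i : ℤ) : ℚ) := by
    intro F
    simp [φ, mul_comm]
  have hinj : Function.Injective (Int.castRingHom ℚ) := Int.cast_injective
  have hvan : ∀ P : ℤ[X], (∀ i, |(P.coeff i : ℝ)| ≤ h) → |aeval ζ P| ≤ ε →
      ∀ i, i + (P.map (Int.castRingHom ℚ)).natDegree ≤ 2 * n - 1 →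
        φ (X ^ i * P.map (Int.castRingHom ℚ)) = 0 := by
    intro P hPh hPε i hi
    rw [natDegree_map_eq_of_injective hinj] at hi
    have h1 := hφ (X ^ i * P)
    rw [sum_coeff_X_pow_mul_eq_zero hPh hPε (hzx ▸ hx) hz hcon i hi] at h1
    simpa using h1
  have hz0 : ∀ i ≤ m, z i = 0 := by
    intro i hi
    have h1 : φ (X ^ i) = 0 :=
      linearMap_eq_zero_of_isCoprime hn φ
        ((Polynomial.map_ne_zero_iff hinj).mpr hR0) (natDegree_map_le.trans hR)
        (natDegree_map_le.trans hQ) hRQ (hvan R hRh hRε) (hvan Q hQh hQε)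
        (by simpa using hi)
    have h2 := hφ (X ^ i)
    rw [Polynomial.map_pow, map_X, h1] at h2
    have h3 : ∑ j ∈ Finset.range (m + 1), (X ^ i : ℤ[X]).coeff j * z j = z i := by
      simp only [coeff_X_pow, ite_mul, one_mul, zero_mul]
      rw [Finset.sum_ite_eq' (Finset.range (m + 1)) i z, if_pos (Finset.mem_range_succ_iff.mpr hi)]
    rw [h3] at h2
    exact_mod_cast h2.symm
  apply hne
  refine Prod.ext (hzx ▸ hz0 0 (Nat.zero_le _)) (funext fun i => ?_)
  exact (hzy i).symm.trans (hz0 (i + 1) i.2)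

theorem simulExponent_mul_polyExponent_le_one {ζ : ℝ} (hζ : Transcendental ℚ ζ) {n : ℕ}
    (hn : 1 ≤ n) {w η : ℝ} (hw : 0 < w) (h : ∀ᶠ X in atTop, PolySolvable n ζ w X)
    (hη : ∀ᶠ X in atTop, SimulSolvable (2 * n - 1) ζ η X) : η * w ≤ 1 := by
  by_contra! hcon
  have hη0 : 0 < η := by
    by_contra! h0
    nlinarith
  have hlt : 1 / η < w := by rwa [div_lt_iff₀' hη0]
  obtain ⟨w', hw'1, hw'2⟩ := exists_between hlt
  -- The approximation will be taken at `X = M ^ s`, with `M` the measure of `R`. The two error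
  -- terms have sizes `M ^ (s - w')` and `M ^ (1 - η * s)`, and both decay because `1 / η < s < w'`.
  obtain ⟨s, hs1, hs2⟩ := exists_between hw'1
  have hs0 : 0 < s := (by positivity : 0 < 1 / η).trans hs1
  have hsη : 1 < η * s := by rwa [div_lt_iff₀' hη0] at hs1
  -- A polynomial of degree at most `n` and height at most `c * M` has Mahler measure at most `M /
  -- 2`, so it is not a nonzero multiple of `R`.
  set c : ℝ := 1 / (2 * (n + 1)) with hc
  have hc0 : 0 < c := by positivity
  have hc1 : c ≤ 1 := by
    rw [hc, div_le_one (by positivity)]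
    linarith [(Nat.cast_nonneg n : (0 : ℝ) ≤ n)]
  have hcw : 1 ≤ c ^ (-w) := Real.one_le_rpow_of_pos_of_le_one_of_nonpos hc0 hc1 (by linarith)
  have hlim : Tendsto (fun M : ℝ => (max 1 |ζ| ^ (2 * n - 1) * c ^ (-w)) * M ^ (-(w' - s)) +
      (((2 * n - 1 : ℕ) + 1) * 2 ^ n) * M ^ (-(η * s - 1))) atTop (𝓝 0) := by
    have h1 := (tendsto_rpow_neg_atTop (sub_pos.mpr hs2)).const_mul
      (max 1 |ζ| ^ (2 * n - 1) * c ^ (-w))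
    have h2 := (tendsto_rpow_neg_atTop (sub_pos.mpr hsη)).const_mul
      ((((2 * n - 1 : ℕ) : ℝ) + 1) * 2 ^ n)
    simpa using h1.add h2
  have hev := (hlim.eventually_lt_const zero_lt_one).and
    (((tendsto_rpow_atTop hs0).eventually hη).and
      ((((tendsto_id.const_mul_atTop hc0)).eventually h).and (eventually_ge_atTop 1)))
  obtain ⟨K, hK⟩ := eventually_atTop.mp hev
  obtain ⟨R, hR, hRn, hRK, hRw⟩ := exists_irreducible_abs_aeval_lt hζ
    ((by positivity : (0 : ℝ) ≤ 1 / η).trans hw'1.le) hw'2 h K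
  obtain ⟨hsmall, hsol, ⟨Q, hQn, hQc, hQ0, hQw⟩, hM1⟩ := hK _ hRK.le
  set M := (R.map (Int.castRingHom ℂ)).mahlerMeasure with hM
  have hM0 : 0 < M := by linarith
  simp only [id] at hQc hQw
  have hQne : Q ≠ 0 := by rintro rfl; simp at hQ0
  have hw'0 : 0 < w' := hs0.trans hs2
  have hRd : R.natDegree ≠ 0 := by
    intro hd
    obtain ⟨a, ha⟩ := natDegree_eq_zero.mp hd
    have ha0 : a ≠ 0 := by rintro rfl; exact hR.ne_zero (by simpa using ha.symm)
    have h1 : (1 : ℝ) ≤ |aeval ζ R| := by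
      rw [← ha]
      simpa using show (1 : ℝ) ≤ |(a : ℝ)| from by exact_mod_cast Int.one_le_abs ha0
    have h2 := Real.rpow_le_one_of_one_le_of_nonpos hM1 (show -w' ≤ 0 by linarith)
    linarith
  have hdvd : ¬ R ∣ Q := by
    rintro ⟨T, rfl⟩
    have hT : T ≠ 0 := right_ne_zero_of_mul hQne
    have h1 := mahlerMeasure_le_of_abs_coeff_le hQn hQc
    rw [Polynomial.map_mul, mahlerMeasure_mul, ← hM] at h1
    have h2 := one_le_mahlerMeasure_of_ne_zero hT
    have h3 : ((n : ℝ) + 1) * (c * M) = M / 2 := by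
      rw [hc]
      field_simp
    nlinarith
  have h2n : (1 : ℝ) ≤ 2 ^ n := one_le_pow₀ (by norm_num)
  have hmain := hsol.one_le hn hR.ne_zero hRn hQn (isCoprime_map_of_irreducible hR hRd hdvd)
    (h := 2 ^ n * M) (ε := c ^ (-w) * M ^ (-w'))
    (abs_coeff_le_two_pow_mul_mahlerMeasure hRn)
    (fun i => (hQc i).trans (by nlinarith))
    (hRw.le.trans (le_mul_of_one_le_left (by positivity) hcw))
    (hQw.trans (by
      rw [Real.mul_rpow hc0.le hM0.le]
      gcongr))
  have e1 : M ^ (-(w' - s)) = M ^ s * M ^ (-w') := by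
    rw [← Real.rpow_add hM0]
    ring_nf
  have e2 : M ^ (-(η * s - 1)) = M * (M ^ s) ^ (-η) := by
    rw [← Real.rpow_mul hM0.le]
    nth_rewrite 2 [← Real.rpow_one M]
    rw [← Real.rpow_add hM0]
    ring_nf
  rw [e1, e2] at hsmall
  linarith

end Coprime

/-! ### Polynomials and integer points as vectors of dual lattices -/

section Vectors

variable {n : ℕ}

/-- The vector `(P(ζ), p_1, …, p_n)` attached to the polynomial with coefficient vector `p`. -/
def polyVec (ζ : ℝ) (p : Fin (n + 1) → ℤ) : Fin (n + 1) → ℝ :=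
  Fin.cons (∑ i : Fin (n + 1), ζ ^ (i : ℕ) * (p i : ℝ)) fun i => (p i.succ : ℝ)

/-- The vector `(z_0, z_1 - ζ * z_0, …, z_n - ζ ^ n * z_0)` attached to an integer point. -/
def pointVec (ζ : ℝ) (z : Fin (n + 1) → ℤ) : Fin (n + 1) → ℝ :=
  Fin.cons (z 0 : ℝ) fun i => (z i.succ : ℝ) - ζ ^ ((i : ℕ) + 1) * z 0

theorem polyVec_dotProduct_pointVec (ζ : ℝ) (p z : Fin (n + 1) → ℤ) :
    polyVec ζ p ⬝ᵥ pointVec ζ z = ((∑ i, p i * z i : ℤ) : ℝ) := by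
  rw [dotProduct, Fin.sum_univ_succ, Fin.sum_univ_succ]
  simp only [polyVec, pointVec, Fin.cons_zero, Fin.cons_succ]
  rw [Fin.sum_univ_succ]
  push_cast
  rw [add_mul, Finset.sum_mul, add_assoc, ← Finset.sum_add_distrib]
  congr 1
  · simp
  · refine Finset.sum_congr rfl fun i _ => ?_
    simp only [Fin.val_succ]
    ring

/-- The unimodular matrix mapping a coefficient vector `p` to `polyVec ζ p`. -/
def polyMatrix (n : ℕ) (ζ : ℝ) : Matrix (Fin (n + 1)) (Fin (n + 1)) ℝ :=
  updateRow 1 0 fun i => ζ ^ (i : ℕ)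

/-- The unimodular matrix mapping an integer point `z` to `pointVec ζ z`. -/
def pointMatrix (n : ℕ) (ζ : ℝ) : Matrix (Fin (n + 1)) (Fin (n + 1)) ℝ :=
  updateCol 1 0 (Fin.cons 1 fun i => -ζ ^ ((i : ℕ) + 1))

theorem det_polyMatrix (ζ : ℝ) : (polyMatrix n ζ).det = 1 := by
  rw [polyMatrix, det_updateRow_one]
  simp

theorem det_pointMatrix (ζ : ℝ) : (pointMatrix n ζ).det = 1 := by
  rw [pointMatrix, ← cramer_apply]
  simp

theorem polyMatrix_mulVec (ζ : ℝ) (p : Fin (n + 1) → ℤ) :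
    polyMatrix n ζ *ᵥ (fun i => (p i : ℝ)) = polyVec ζ p := by
  ext i
  rw [polyMatrix, updateRow_one_mulVec]
  refine Fin.cases ?_ (fun i => ?_) i
  · simp [polyVec, dotProduct]
  · simp [polyVec]

theorem pointMatrix_mulVec (ζ : ℝ) (z : Fin (n + 1) → ℤ) :
    pointMatrix n ζ *ᵥ (fun i => (z i : ℝ)) = pointVec ζ z := by
  ext i
  rw [pointMatrix, mulVec, dotProduct, Fin.sum_univ_succ]
  refine Fin.cases ?_ (fun i => ?_) i
  · simp [pointVec, one_apply, Fin.succ_ne_zero, (Fin.succ_ne_zero _).symm]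
  · simp [pointVec, one_apply, Fin.succ_ne_zero]
    ring

theorem dualIntegral_polyVec (ζ : ℝ) (p : Fin (n + 1) → ℤ) :
    DualIntegral (pointMatrix n ζ) (polyVec ζ p) := fun z =>
  ⟨_, by rw [pointMatrix_mulVec, polyVec_dotProduct_pointVec]⟩

theorem dualIntegral_pointVec (ζ : ℝ) (z : Fin (n + 1) → ℤ) :
    DualIntegral (polyMatrix n ζ) (pointVec ζ z) := fun p =>
  ⟨_, by rw [polyMatrix_mulVec, dotProduct_comm, polyVec_dotProduct_pointVec]⟩

theorem simulSolvable_iff {ζ η X₀ : ℝ} : SimulSolvable n ζ η X₀ ↔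
    ∃ z : Fin (n + 1) → ℤ, z ≠ 0 ∧ |pointVec ζ z 0| ≤ X₀ ∧
      ∀ i : Fin n, |pointVec ζ z i.succ| ≤ X₀ ^ (-η) := by
  constructor
  · rintro ⟨x, y, hne, hx, hy⟩
    refine ⟨Fin.cons x y, ?_, by simpa [pointVec] using hx, fun i => ?_⟩
    · intro h
      apply hne
      refine Prod.ext ?_ (funext fun i => ?_)
      · simpa using congrFun h 0
      · simpa using congrFun h i.succ
    · simpa [pointVec, abs_sub_comm] using hy i
  · rintro ⟨z, hne, hx, hy⟩
    refine ⟨z 0, fun i => z i.succ, ?_, by simpa [pointVec] using hx, fun i => ?_⟩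
    · intro h
      apply hne
      ext i
      refine Fin.cases ?_ (fun i => ?_) i
      · exact congrArg Prod.fst h
      · exact congrFun (congrArg Prod.snd h) i
    · simpa [pointVec, abs_sub_comm] using hy i

theorem aeval_ofFn (ζ : ℝ) (p : Fin (n + 1) → ℤ) :
    aeval ζ (ofFn (n + 1) p) = polyVec ζ p 0 := by
  rw [aeval_eq_sum_range' (ofFn_natDegree_lt (Nat.le_add_left 1 n) p), Finset.sum_range]
  have h : ∀ i : Fin (n + 1), (ofFn (n + 1) p).coeff i = p i := fun i =>
    ofFn_coeff_eq_val_of_lt p i.2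
  simp [polyVec, h, mul_comm]

theorem ofFn_ne_zero {p : Fin (n + 1) → ℤ} (hp : p ≠ 0) : ofFn (n + 1) p ≠ 0 := by
  intro h
  apply hp
  ext i
  have := ofFn_coeff_eq_val_of_lt p i.2
  rw [h] at this
  simpa using this.symm

theorem polyVec_zero_ne_zero {ζ : ℝ} (hζ : Transcendental ℚ ζ) {p : Fin (n + 1) → ℤ}
    (hp : p ≠ 0) : polyVec ζ p 0 ≠ 0 := by
  rw [← aeval_ofFn]
  exact aeval_ne_zero_of_transcendental hζ (ofFn_ne_zero hp)

theorem polySolvable_iff {ζ : ℝ} (hζ : Transcendental ℚ ζ) {η X₀ : ℝ} :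
    PolySolvable n ζ η X₀ ↔ ∃ p : Fin (n + 1) → ℤ, p ≠ 0 ∧ (∀ i, |(p i : ℝ)| ≤ X₀) ∧
      |polyVec ζ p 0| ≤ X₀ ^ (-η) := by
  constructor
  · rintro ⟨P, hd, hc, h0, hP⟩
    have he : ofFn (n + 1) (fun i : Fin (n + 1) => P.coeff i) = P := by
      ext i
      by_cases hi : i < n + 1
      · rw [ofFn_coeff_eq_val_of_lt _ hi]
      · rw [ofFn_coeff_eq_zero_of_ge _ (not_lt.mp hi), coeff_eq_zero_of_natDegree_lt (by omega)]
    refine ⟨fun i => P.coeff i, ?_, fun i => hc i, ?_⟩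
    · intro h
      rw [h, map_zero] at he
      simp [← he] at h0
    · rwa [← aeval_ofFn, he]
  · rintro ⟨p, hp, hc, hP⟩
    refine ⟨ofFn (n + 1) p, Nat.le_of_lt_succ (ofFn_natDegree_lt (Nat.le_add_left 1 n) p),
      fun i => ?_, ?_, by rwa [aeval_ofFn]⟩
    · by_cases hi : i < n + 1
      · rw [ofFn_coeff_eq_val_of_lt _ hi]
        exact hc _
      · rw [ofFn_coeff_eq_zero_of_ge _ (not_lt.mp hi)]
        simpa using (abs_nonneg _).trans (hc 0)
    · rw [aeval_ofFn]
      exact abs_pos.mpr (polyVec_zero_ne_zero hζ hp)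

/-- The constant coefficient is not an entry of `polyVec`; it is recovered from the value at `ζ` and
the other coefficients. -/
theorem abs_coeff_zero_le (ζ : ℝ) (p : Fin (n + 1) → ℤ) {B : ℝ}
    (hB : ∀ i : Fin n, |polyVec ζ p i.succ| ≤ B) :
    |(p 0 : ℝ)| ≤ |polyVec ζ p 0| + n * (max 1 |ζ| ^ n * B) := by
  have h1 : (p 0 : ℝ) = polyVec ζ p 0 -
      ∑ i : Fin n, ζ ^ ((i : ℕ) + 1) * polyVec ζ p i.succ := by
    simp only [polyVec, Fin.cons_zero, Fin.cons_succ]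
    rw [Fin.sum_univ_succ]
    simp
  rw [h1]
  refine (abs_sub _ _).trans (add_le_add le_rfl (abs_sum_le_card_mul fun i => ?_))
  rw [abs_mul, abs_pow]
  refine mul_le_mul ?_ (hB i) (abs_nonneg _) (by positivity)
  calc |ζ| ^ ((i : ℕ) + 1) ≤ max 1 |ζ| ^ ((i : ℕ) + 1) :=
        pow_le_pow_left₀ (abs_nonneg _) (le_max_right _ _) _
    _ ≤ _ := pow_le_pow_right₀ (le_max_left _ _) i.2

end Vectors

/-! ### Pairs of consecutive minimal points -/

section MinimalPoints

variable {n : ℕ} {ζ : ℝ}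

theorem eventually_rpow_lt_abs_sub (hζ : Irrational ζ) {μ : ℝ} (hμ : 0 < μ) (K : ℕ) :
    ∀ᶠ X in atTop, ∀ x ∈ Set.Icc (-(K : ℤ)) K, x ≠ 0 → ∀ y : ℤ,
      X ^ (-μ) < |(y : ℝ) - ζ * x| := by
  rw [eventually_all_finite (Set.finite_Icc _ _)]
  intro x _
  by_cases hx : x = 0
  · simp [hx]
  have hpos : 0 < |ζ * x - round (ζ * x)| :=
    abs_pos.mpr (sub_ne_zero.mpr ((hζ.mul_intCast hx).ne_int _))
  filter_upwards [(tendsto_rpow_neg_atTop hμ).eventually_lt_const hpos] with X hX _ y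
  rw [abs_sub_comm]
  exact hX.trans_le (round_le _ _)

/-- Two linearly independent integer points, consecutive in a suitable sense, which are good
simultaneous approximations. -/
theorem eventually_exists_point_pair (hn : 1 ≤ n) (hζ : Irrational ζ) {μ : ℝ} (hμ : 0 < μ)
    (hμ1 : μ < 1) (h : ∀ᶠ X in atTop, SimulSolvable n ζ μ X) :
    ∀ᶠ X in atTop, ∃ z z' : Fin (n + 1) → ℤ, pointVec ζ z 0 ≠ 0 ∧
      (∃ i : Fin n, pointVec ζ z 0 * pointVec ζ z' i.succ -
        pointVec ζ z' 0 * pointVec ζ z i.succ ≠ 0) ∧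
      (∀ i : Fin n, |pointVec ζ z i.succ| ≤ X ^ (-μ)) ∧
      ∀ i : Fin n, |pointVec ζ z 0 * pointVec ζ z' i.succ -
        pointVec ζ z' 0 * pointVec ζ z i.succ| ≤ 4 * X ^ (1 - μ) := by
  classical
  obtain ⟨X₀, hX₀⟩ := eventually_atTop.mp h
  obtain ⟨K, hK⟩ := exists_nat_ge (max X₀ 1)
  have hK0 : X₀ ≤ K := (le_max_left _ _).trans hK
  have hK1 : (1 : ℝ) ≤ K := (le_max_right _ _).trans hK
  filter_upwards [h, eventually_rpow_lt_abs_sub hζ hμ K, eventually_gt_atTop 1]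
    with X hX hXK hX1
  have hX0 : 0 < X := by linarith
  have hXμ : X ^ (-μ) < 1 := Real.rpow_lt_one_of_one_lt_of_neg hX1 (by linarith)
  rw [simulSolvable_iff] at hX
  -- Among the solutions at `X`, `z` is taken with `|z 0| = k` least. Irrationality forces `k > K`,
  -- so the system is also solvable at `k - 1`, which gives `z'` with `|z' 0| < k`. Were `z'`
  -- proportional to `z`, its errors would be no larger, against minimality.
  have hex : ∃ k : ℕ, ∃ z : Fin (n + 1) → ℤ, (z 0).natAbs = k ∧ z ≠ 0 ∧
      |pointVec ζ z 0| ≤ X ∧ ∀ i : Fin n, |pointVec ζ z i.succ| ≤ X ^ (-μ) := by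
    obtain ⟨z, hz⟩ := hX
    exact ⟨_, z, rfl, hz⟩
  obtain ⟨z, hzk, hz0, hzX, hze⟩ := Nat.find_spec hex
  set k := Nat.find hex with hk
  have hmin : ∀ z' : Fin (n + 1) → ℤ, z' ≠ 0 → |pointVec ζ z' 0| ≤ X →
      (∀ i : Fin n, |pointVec ζ z' i.succ| ≤ X ^ (-μ)) → k ≤ (z' 0).natAbs :=
    fun z' h1 h2 h3 => Nat.find_min' hex ⟨z', rfl, h1, h2, h3⟩
  clear_value k
  have hz00 : z 0 ≠ 0 := by
    intro h0
    apply hz0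
    ext i
    refine Fin.cases (by simpa using h0) (fun i => ?_) i
    have h1 := (hze i).trans_lt hXμ
    simp only [pointVec, Fin.cons_succ, h0, Int.cast_zero, mul_zero, sub_zero] at h1
    simpa using Int.abs_lt_one_iff.mp (by exact_mod_cast h1)
  have hkabs : |pointVec ζ z 0| = k := by
    rw [← hzk, Nat.cast_natAbs]
    simp [pointVec]
  have hKk : K < k := by
    by_contra! hle
    have h1 := hXK (z 0) (by rw [Set.mem_Icc]; omega) hz00 (z (Fin.succ ⟨0, hn⟩))
    have h2 := hze ⟨0, hn⟩
    simp only [pointVec, Fin.cons_succ, zero_add, pow_one] at h2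
    linarith
  have hKk' : (K : ℝ) + 1 ≤ k := by exact_mod_cast hKk
  have hsol := hX₀ ((k : ℝ) - 1) (by linarith)
  rw [simulSolvable_iff] at hsol
  obtain ⟨z', hz'0, hz'X, hz'e⟩ := hsol
  have hkX : (k : ℝ) ≤ X := hkabs ▸ hzX
  have hk1 : (0 : ℝ) < (k : ℝ) - 1 := by linarith
  refine ⟨z, z', by simpa [pointVec] using hz00, ?_, hze, fun i => ?_⟩
  · by_contra! hall
    have hlt : |pointVec ζ z' 0| < |pointVec ζ z 0| := by
      rw [hkabs]
      linarith
    have hle : k ≤ (z' 0).natAbs := by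
      refine hmin z' hz'0 (hz'X.trans (by linarith)) fun i => ?_
      refine le_trans ?_ (hze i)
      have h1 : |pointVec ζ z 0| * |pointVec ζ z' i.succ| =
          |pointVec ζ z' 0| * |pointVec ζ z i.succ| := by
        rw [← abs_mul, ← abs_mul, sub_eq_zero.mp (hall i)]
      have h2 : |pointVec ζ z 0| * |pointVec ζ z' i.succ| ≤
          |pointVec ζ z 0| * |pointVec ζ z i.succ| := by
        rw [h1]
        exact mul_le_mul_of_nonneg_right hlt.le (abs_nonneg _)
      exact le_of_mul_le_mul_left h2 ((abs_nonneg _).trans_lt hlt)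
    have hle' : (k : ℝ) ≤ |pointVec ζ z' 0| := by
      have : (k : ℝ) ≤ ((z' 0).natAbs : ℝ) := by exact_mod_cast hle
      rw [Nat.cast_natAbs] at this
      simpa [pointVec] using this
    linarith
  · have h1 : X ^ (-μ) ≤ ((k : ℝ) - 1) ^ (-μ) :=
      Real.rpow_le_rpow_of_nonpos hk1 (by linarith) (by linarith)
    have hpos : 0 < ((k : ℝ) - 1) ^ (-μ) := by positivity
    calc _ ≤ |pointVec ζ z 0| * |pointVec ζ z' i.succ| +
          |pointVec ζ z' 0| * |pointVec ζ z i.succ| := by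
          rw [← abs_mul, ← abs_mul]
          exact abs_sub _ _
      _ ≤ (2 * ((k : ℝ) - 1)) * ((k : ℝ) - 1) ^ (-μ) +
          (2 * ((k : ℝ) - 1)) * ((k : ℝ) - 1) ^ (-μ) := by
          refine add_le_add (mul_le_mul ?_ (hz'e i) (abs_nonneg _) (by linarith))
            (mul_le_mul ?_ ((hze i).trans h1) (abs_nonneg _) (by linarith))
          · rw [hkabs]
            linarith
          · linarith
      _ = 4 * ((k : ℝ) - 1) ^ (1 - μ) := by
          rw [sub_eq_add_neg 1 μ, Real.rpow_add hk1, Real.rpow_one]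
          ring
      _ ≤ 4 * X ^ (1 - μ) := by
          have := Real.rpow_le_rpow hk1.le (show (k : ℝ) - 1 ≤ X by linarith)
            (show 0 ≤ 1 - μ by linarith)
          linarith

/-- Two linearly independent integer polynomials, consecutive in a suitable sense, which take
small values. -/
theorem eventually_exists_poly_pair (hζ : Transcendental ℚ ζ) {v : ℝ} (hv : 1 < v)
    (h : ∀ᶠ X in atTop, PolySolvable n ζ v X) :
    ∀ᶠ X in atTop, ∃ p q : Fin (n + 1) → ℤ, polyVec ζ p 0 ≠ 0 ∧
      (∃ i : Fin n, polyVec ζ p 0 * polyVec ζ q i.succ -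
        polyVec ζ q 0 * polyVec ζ p i.succ ≠ 0) ∧
      (∀ i : Fin n, |polyVec ζ p i.succ| ≤ X) ∧
      ∀ i : Fin n, |polyVec ζ p 0 * polyVec ζ q i.succ -
        polyVec ζ q 0 * polyVec ζ p i.succ| ≤ 4 * X ^ (-(v - 1)) := by
  obtain ⟨X₀, hX₀⟩ := eventually_atTop.mp h
  filter_upwards [h, eventually_ge_atTop X₀, eventually_gt_atTop 0] with X hX hXX hX0
  rw [polySolvable_iff hζ] at hX
  have hfin : {p : Fin (n + 1) → ℤ | p ≠ 0 ∧ ∀ i, |(p i : ℝ)| ≤ X}.Finite := by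
    refine (Set.finite_Icc (fun _ => -⌊X⌋) (fun _ => ⌊X⌋)).subset ?_
    rintro p ⟨-, hp⟩
    have : ∀ i, |p i| ≤ ⌊X⌋ := fun i => Int.le_floor.mpr (by simpa using hp i)
    exact ⟨fun i => (abs_le.mp (this i)).1, fun i => (abs_le.mp (this i)).2⟩
  obtain ⟨p₀, hp₀, hp₀c, hp₀v⟩ := hX
  -- Here `p` minimizes the value at `ζ` among nonzero vectors of height at most `X`. Any multiple
  -- of `p` with a smaller value would have no larger coefficients, so a vector with a smaller value
  -- is independent of `p`.
  obtain ⟨p, ⟨hp0, hpc⟩, hpmin⟩ := hfin.exists_minimalFor (fun p => |polyVec ζ p 0|) _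
    ⟨p₀, hp₀, hp₀c⟩
  have hmin : ∀ q : Fin (n + 1) → ℤ, q ≠ 0 → (∀ i, |(q i : ℝ)| ≤ X) →
      |polyVec ζ p 0| ≤ |polyVec ζ q 0| := by
    intro q hq hqc
    by_contra! hlt
    exact absurd (hpmin ⟨hq, hqc⟩ hlt.le) (not_le.mpr hlt)
  set L := |polyVec ζ p 0| with hL
  have hp00 := polyVec_zero_ne_zero hζ hp0
  have hL0 : 0 < L := abs_pos.mpr hp00
  have hLX : L ≤ X ^ (-v) := (hmin p₀ hp₀ hp₀c).trans hp₀v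
  have hv0 : 0 < v := by linarith
  -- The height at which exponent `v` guarantees exactly the value `L`; passing to `2 * Y` makes the
  -- value of `q` strictly smaller.
  set Y := L ^ (-(1 / v)) with hY
  have hYX : X ≤ Y := by
    have := Real.rpow_le_rpow_of_nonpos hL0 hLX (show -(1 / v) ≤ 0 by
      have : 0 < 1 / v := by positivity
      linarith)
    rw [← Real.rpow_mul hX0.le, show -v * -(1 / v) = 1 by field_simp, Real.rpow_one] at this
    exact this
  have hY0 : 0 < Y := hX0.trans_le hYX
  have hYv : Y ^ (-v) = L := by
    rw [hY, ← Real.rpow_mul hL0.le, show -(1 / v) * -v = 1 by field_simp, Real.rpow_one]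
  have hsol := hX₀ (2 * Y) (by linarith)
  rw [polySolvable_iff hζ] at hsol
  obtain ⟨q, hq0, hqc, hqv⟩ := hsol
  have hqL : |polyVec ζ q 0| < L := by
    refine hqv.trans_lt ?_
    rw [Real.mul_rpow (by norm_num) hY0.le, hYv]
    have := Real.rpow_lt_one_of_one_lt_of_neg (show (1 : ℝ) < 2 by norm_num)
      (show -v < 0 by linarith)
    nlinarith
  refine ⟨p, q, hp00, ?_, fun i => by simpa [polyVec] using hpc i.succ, fun i => ?_⟩
  · by_contra! hall
    have hprop : ∀ i, polyVec ζ p 0 * q i = polyVec ζ q 0 * p i := by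
      have hs : ∀ i : Fin n, polyVec ζ p 0 * q i.succ = polyVec ζ q 0 * p i.succ := by
        intro i
        simpa [polyVec] using sub_eq_zero.mp (hall i)
      intro i
      refine Fin.cases ?_ hs i
      have e : ∀ r : Fin (n + 1) → ℤ, (r 0 : ℝ) = polyVec ζ r 0 -
          ∑ i : Fin n, ζ ^ ((i : ℕ) + 1) * r i.succ := by
        intro r
        simp only [polyVec, Fin.cons_zero]
        rw [Fin.sum_univ_succ]
        simp
      rw [e p, e q, mul_sub, mul_sub, Finset.mul_sum, Finset.mul_sum]
      congr 1
      · ring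
      · refine Finset.sum_congr rfl fun i _ => ?_
        linear_combination ζ ^ ((i : ℕ) + 1) * hs i
    refine absurd (hmin q hq0 fun i => ?_) (not_le.mpr hqL)
    refine le_trans ?_ (hpc i)
    have h1 : L * |(q i : ℝ)| = |polyVec ζ q 0| * |(p i : ℝ)| := by
      rw [hL, ← abs_mul, ← abs_mul, hprop]
    have h2 : L * |(q i : ℝ)| ≤ L * |(p i : ℝ)| := by
      rw [h1]
      exact mul_le_mul_of_nonneg_right hqL.le (abs_nonneg _)
    exact le_of_mul_le_mul_left h2 hL0
  · have hq' : |polyVec ζ q i.succ| ≤ 2 * Y := by simpa [polyVec] using hqc i.succ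
    have hp' : |polyVec ζ p i.succ| ≤ 2 * Y := by
      have : |polyVec ζ p i.succ| ≤ X := by simpa [polyVec] using hpc i.succ
      linarith
    calc _ ≤ |polyVec ζ p 0| * |polyVec ζ q i.succ| +
          |polyVec ζ q 0| * |polyVec ζ p i.succ| := by
          rw [← abs_mul, ← abs_mul]
          exact abs_sub _ _
      _ ≤ L * (2 * Y) + L * (2 * Y) :=
          add_le_add (mul_le_mul le_rfl hq' (abs_nonneg _) hL0.le)
            (mul_le_mul hqL.le hp' (abs_nonneg _) hL0.le)
      _ = 4 * Y ^ (-(v - 1)) := by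
          rw [show -(v - 1) = -v + 1 by ring, Real.rpow_add hY0, hYv, Real.rpow_one]
          ring
      _ ≤ 4 * X ^ (-(v - 1)) := by
          have := Real.rpow_le_rpow_of_nonpos hX0 hYX (show -(v - 1) ≤ 0 by linarith)
          linarith

end MinimalPoints

/-! ### German's transference inequalities -/

section German

variable {n : ℕ} {ζ : ℝ}

theorem eventually_mul_rpow_lt_mul_rpow {a b C D : ℝ} (hab : a < b) (hD : 0 < D) :
    ∀ᶠ x : ℝ in atTop, C * x ^ a < D * x ^ b := by
  filter_upwards [(tendsto_rpow_atTop (sub_pos.mpr hab)).eventually_gt_atTop (C / D),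
    eventually_gt_atTop 0] with x hx hx0
  rw [div_lt_iff₀' hD] at hx
  calc C * x ^ a < D * x ^ (b - a) * x ^ a := mul_lt_mul_of_pos_right hx (by positivity)
    _ = D * x ^ b := by
      rw [mul_assoc, ← Real.rpow_add hx0]
      ring_nf

/-- German's transference inequality, from simultaneous approximation to polynomials. -/
theorem eventually_polySolvable_of_simulSolvable (hn : 1 ≤ n) (hζ : Transcendental ℚ ζ)
    {μ w : ℝ} (hμ : 0 < μ) (hμ1 : μ < 1) (hw : 0 < w) (hwμ : w * (1 - μ) < n - 1)
    (h : ∀ᶠ X in atTop, SimulSolvable n ζ μ X) : ∀ᶠ X in atTop, PolySolvable n ζ w X := by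
  have hlt : w < (n - 1) / (1 - μ) := by rwa [lt_div_iff₀ (by linarith)]
  -- Polynomials of height about `H` are built from integer points at scale `H ^ s`. The bound `s *
  -- (1 - μ) < n - 1` controls the minors, and together with `w < s` it controls the entries of the
  -- first point.
  obtain ⟨s, hs1, hs2⟩ := exists_between hlt
  rw [lt_div_iff₀ (by linarith)] at hs2
  have hs0 : 0 < s := hw.trans hs1
  have hn1 : (1 : ℝ) ≤ n := by exact_mod_cast hn
  set D : ℝ := max 1 |ζ| ^ n with hD
  have hD1 : 1 ≤ D := one_le_pow₀ (le_max_left _ _)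
  -- Absorbs the factors `n ^ 2` and `n` lost in the transfer and the factor `n * D` lost in
  -- recovering the constant coefficient, leaving half of `H` to spare for the value at `ζ`.
  set c : ℝ := 1 / (2 * (n ^ 2 * D)) with hc
  have hc0 : 0 < c := by positivity
  have hcD : n ^ 2 * (D * c) = 1 / 2 := by
    rw [hc]
    field_simp
  have hcn : n ^ 2 * c ≤ 1 / 2 := by
    rw [← hcD]
    have : (0 : ℝ) < n ^ 2 := by positivity
    nlinarith [mul_pos this hc0]
  have e1 := eventually_mul_rpow_lt_mul_rpow (a := s * -μ) (b := -w + (n - 1 : ℕ)) (C := 1)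
    (D := c * c ^ (n - 1)) (by push_cast [hn]; nlinarith) (by positivity)
  have e2 := eventually_mul_rpow_lt_mul_rpow (a := s * (1 - μ)) (b := (n - 1 : ℕ)) (C := 4)
    (D := c ^ (n - 1)) (by push_cast [hn]; linarith) (by positivity)
  filter_upwards [e1, e2, eventually_ge_atTop 1, (tendsto_rpow_atTop hs0).eventually
    (eventually_exists_point_pair hn hζ.irrational hμ hμ1 h)] with H h1 h2 hH1 hpair
  have hH0 : 0 < H := by linarith
  obtain ⟨z, z', hz0, hind, hz, hzz⟩ := hpair
  obtain ⟨p, hp0, hpv, hpi⟩ := exists_int_vec_transfer (M := polyMatrix n ζ) hn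
    (by rw [det_polyMatrix, abs_one])
    (dualIntegral_pointVec ζ z) (dualIntegral_pointVec ζ z') (A := c * H ^ (-w)) (B := c * H)
    (by positivity) (by positivity) hz0 hind
    (fun i => by
      refine (hz i).trans_lt ?_
      rw [← Real.rpow_mul hH0.le, mul_pow, ← Real.rpow_natCast H]
      rw [Real.rpow_add hH0] at h1
      linarith)
    (fun i => by
      refine (hzz i).trans_lt ?_
      rw [← Real.rpow_mul hH0.le, mul_pow, ← Real.rpow_natCast H]
      linarith)
  rw [polyMatrix_mulVec] at hpv hpi
  rw [polySolvable_iff hζ]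
  have hHw : H ^ (-w) ≤ 1 := Real.rpow_le_one_of_one_le_of_nonpos hH1 (by linarith)
  have hHw0 : 0 < H ^ (-w) := by positivity
  have hpv' : |polyVec ζ p 0| ≤ 1 / 2 * H ^ (-w) := by
    refine hpv.trans ?_
    rw [← mul_assoc]
    exact mul_le_mul_of_nonneg_right hcn hHw0.le
  refine ⟨p, hp0, fun i => ?_, hpv'.trans (by linarith)⟩
  refine Fin.cases ?_ (fun i => ?_) i
  · refine (abs_coeff_zero_le ζ p hpi).trans ?_
    have e : n * (max 1 |ζ| ^ n * (n * (c * H))) = 1 / 2 * H := by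
      rw [← hD, ← hcD]
      ring
    rw [e]
    linarith
  · have h3 := hpi i
    have h4 : polyVec ζ p i.succ = p i.succ := by simp [polyVec]
    rw [h4] at h3
    refine h3.trans ?_
    have h5 : (n : ℝ) ≤ n ^ 2 := by nlinarith
    nlinarith [mul_le_mul_of_nonneg_right h5 hc0.le]

/-- German's transference inequality, from polynomials to simultaneous approximation. -/
theorem eventually_simulSolvable_of_polySolvable (hn : 2 ≤ n) (hζ : Transcendental ℚ ζ)
    {v η : ℝ} (hv : 1 < v) (hη : 0 < η) (hηv : η * (n - 1) < 1 - 1 / v)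
    (h : ∀ᶠ X in atTop, PolySolvable n ζ v X) : ∀ᶠ X in atTop, SimulSolvable n ζ η X := by
  have hn2 : (2 : ℝ) ≤ n := by exact_mod_cast hn
  have hn1 : 1 ≤ n := by omega
  have hv0 : 0 < v := by linarith
  have hlt : η * (n - 1) / (v - 1) < 1 - η * (n - 1) := by
    rw [div_lt_iff₀ (by linarith)]
    have h1 : η * (n - 1) * v < (1 - 1 / v) * v := mul_lt_mul_of_pos_right hηv hv0
    rw [sub_mul, one_div_mul_cancel hv0.ne'] at h1
    linarith
  -- Polynomials of height at most `X ^ s` are used: the upper bound on `s` controls their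
  -- coefficients, the lower bound the minors.
  obtain ⟨s, hs1, hs2⟩ := exists_between hlt
  have hs0 : 0 < s := lt_of_le_of_lt (div_nonneg (mul_nonneg hη.le (by linarith))
    (by linarith)) hs1
  rw [div_lt_iff₀ (by linarith)] at hs1
  set c : ℝ := 1 / n ^ 2 with hc
  have hc0 : 0 < c := by positivity
  have hcn : n ^ 2 * c = 1 := by
    rw [hc]
    field_simp
  have e1 := eventually_mul_rpow_lt_mul_rpow (a := s) (b := 1 + -η * (n - 1 : ℕ)) (C := 1)
    (D := c * c ^ (n - 1)) (by push_cast [hn1]; linarith) (by positivity)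
  have e2 := eventually_mul_rpow_lt_mul_rpow (a := s * (-(v - 1))) (b := -η * (n - 1 : ℕ))
    (C := 4) (D := c ^ (n - 1)) (by push_cast [hn1]; linarith) (by positivity)
  filter_upwards [e1, e2, eventually_gt_atTop 0, (tendsto_rpow_atTop hs0).eventually
    (eventually_exists_poly_pair hζ hv h)] with X h1 h2 hX0 hpair
  obtain ⟨p, q, hp0, hind, hp, hpq⟩ := hpair
  obtain ⟨z, hz0, hzv, hzi⟩ := exists_int_vec_transfer (M := pointMatrix n ζ) hn1
    (by rw [det_pointMatrix, abs_one])
    (dualIntegral_polyVec ζ p) (dualIntegral_polyVec ζ q) (A := c * X) (B := c * X ^ (-η))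
    (by positivity) (by positivity) hp0 hind
    (fun i => by
      refine (hp i).trans_lt ?_
      rw [mul_pow, ← Real.rpow_natCast (X ^ (-η)), ← Real.rpow_mul hX0.le]
      rw [Real.rpow_add hX0, Real.rpow_one] at h1
      linarith)
    (fun i => by
      refine (hpq i).trans_lt ?_
      rw [← Real.rpow_mul hX0.le, mul_pow, ← Real.rpow_natCast (X ^ (-η)),
        ← Real.rpow_mul hX0.le]
      linarith)
  rw [pointMatrix_mulVec] at hzv hzi
  rw [simulSolvable_iff]
  refine ⟨z, hz0, hzv.trans ?_, fun i => (hzi i).trans ?_⟩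
  · rw [← mul_assoc, hcn, one_mul]
  · have hX : 0 < X ^ (-η) := by positivity
    have h5 : (n : ℝ) * c ≤ 1 := by
      rw [← hcn]
      have h6 : (n : ℝ) ≤ n ^ 2 := by nlinarith
      exact mul_le_mul_of_nonneg_right h6 hc0.le
    rw [← mul_assoc]
    exact mul_le_of_le_one_left hX.le h5

end German

/-! ### Comparison of the exponents and the extended-real statements -/

section Exponents

variable {n : ℕ} {ζ : ℝ}

/-- Dirichlet's theorem, with a slightly smaller exponent. -/
theorem eventually_simulSolvable_one_div (n : ℕ) (ζ : ℝ) :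
    ∀ᶠ X in atTop, SimulSolvable n ζ (1 / (n + 1)) X := by
  filter_upwards [eventually_gt_atTop 1] with X hX
  have hX0 : 0 < X := by linarith
  obtain ⟨z, hz0, hz⟩ := exists_int_vec_abs_mulVec_lt (pointMatrix n ζ)
    (by rw [det_pointMatrix]; exact one_ne_zero)
    (Fin.cons X fun _ => X ^ (-(1 / ((n : ℝ) + 1))))
    (by
      refine Fin.cases (by simpa using hX0) fun i => ?_
      simp only [Fin.cons_succ]
      positivity)
    (by
      rw [det_pointMatrix, abs_one, Fin.prod_univ_succ]
      simp only [Fin.cons_zero, Fin.cons_succ, Finset.prod_const, Finset.card_univ,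
        Fintype.card_fin]
      rw [← Real.rpow_natCast, ← Real.rpow_mul hX0.le]
      nth_rewrite 1 [← Real.rpow_one X]
      rw [← Real.rpow_add hX0]
      apply Real.one_lt_rpow hX
      have : (0 : ℝ) < n + 1 := by positivity
      field_simp
      linarith)
  rw [pointMatrix_mulVec] at hz
  rw [simulSolvable_iff]
  exact ⟨z, hz0, by simpa using (hz 0).le, fun i => by simpa using (hz i.succ).le⟩

theorem eventually_simulSolvable_mono {η η' : ℝ} (hη : η' ≤ η)
    (h : ∀ᶠ X in atTop, SimulSolvable n ζ η X) : ∀ᶠ X in atTop, SimulSolvable n ζ η' X := by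
  filter_upwards [h, eventually_ge_atTop 1] with X ⟨x, y, hne, hx, hy⟩ hX
  exact ⟨x, y, hne, hx, fun i => (hy i).trans
    (Real.rpow_le_rpow_of_exponent_le hX (neg_le_neg hη))⟩

theorem eventually_simulSolvable_max {η η' : ℝ} (h : ∀ᶠ X in atTop, SimulSolvable n ζ η X)
    (h' : ∀ᶠ X in atTop, SimulSolvable n ζ η' X) :
    ∀ᶠ X in atTop, SimulSolvable n ζ (max η η') X := by
  rcases max_choice η η' with e | e <;> rwa [e]

/-- German's inequality turns `μ` into a polynomial exponent `w` close to `(n - 1) / (1 - μ)`; a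
violation would leave room for `w > 1 / η`. -/
theorem mul_simulExponent_add_simulExponent_le_one (hn : 2 ≤ n) (hζ : Transcendental ℚ ζ)
    {μ η : ℝ} (hμ : ∀ᶠ X in atTop, SimulSolvable n ζ μ X)
    (hη : ∀ᶠ X in atTop, SimulSolvable (2 * n - 1) ζ η X) : (n - 1) * η + μ ≤ 1 := by
  by_contra! hcon
  have hn2 : (2 : ℝ) ≤ n := by exact_mod_cast hn
  have hn1 : (0 : ℝ) < n - 1 := by linarith
  -- Taking the maximum with a Dirichlet exponent makes both exponents positive and only strengthens
  -- `hcon`.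
  have hμ' := eventually_simulSolvable_max hμ (eventually_simulSolvable_one_div n ζ)
  have hη' := eventually_simulSolvable_max hη (eventually_simulSolvable_one_div (2 * n - 1) ζ)
  set μ₁ := max μ (1 / ((n : ℝ) + 1)) with hμ₁
  set η₁ := max η (1 / (((2 * n - 1 : ℕ) : ℝ) + 1)) with hη₁
  have hμ0 : 0 < μ₁ := lt_max_of_lt_right (by positivity)
  have hη0 : 0 < η₁ := lt_max_of_lt_right (by positivity)
  have hcon' : 1 < (n - 1) * η₁ + μ₁ := by
    refine hcon.trans_le (add_le_add ?_ (le_max_left _ _))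
    exact mul_le_mul_of_nonneg_left (le_max_left _ _) hn1.le
  obtain ⟨μ₂, h1, h2⟩ := exists_between (show max 0 (1 - (n - 1) * η₁) < min 1 μ₁ by
    have := mul_pos hn1 hη0
    rw [max_lt_iff, lt_min_iff, lt_min_iff]
    refine ⟨⟨zero_lt_one, hμ0⟩, ?_, ?_⟩ <;> linarith)
  rw [max_lt_iff] at h1
  rw [lt_min_iff] at h2
  obtain ⟨w, hw1, hw2⟩ := exists_between (show 1 / η₁ < (n - 1) / (1 - μ₂) by
    rw [div_lt_div_iff₀ hη0 (by linarith)]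
    linarith)
  have hw0 : 0 < w := (by positivity : 0 < 1 / η₁).trans hw1
  rw [div_lt_iff₀' hη0] at hw1
  rw [lt_div_iff₀ (by linarith)] at hw2
  have hw := eventually_polySolvable_of_simulSolvable (by omega) hζ h1.1 h2.1 hw0 hw2
    (eventually_simulSolvable_mono h2.2.le hμ')
  have := simulExponent_mul_polyExponent_le_one hζ (by omega) hw0 hw hη'
  linarith

/-- German's other inequality, in dimension `2 * n - 1`, supplies `η` close to `(1 - 1 / v) / (2 * n
- 2)`; the factor `2 * n - 2` is that dimension minus one. -/
theorem polyExponent_le_of_polyExponent (hn : 2 ≤ n) (hζ : Transcendental ℚ ζ) {w v : ℝ}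
    (hv : 1 < v) (hw : ∀ᶠ X in atTop, PolySolvable n ζ w X)
    (hvs : ∀ᶠ X in atTop, PolySolvable (2 * n - 1) ζ v X) :
    w ≤ (2 * n - 2) * v / (v - 1) := by
  by_contra! hcon
  have hn2 : (2 : ℝ) ≤ n := by exact_mod_cast hn
  have hn0 : (0 : ℝ) < 2 * n - 2 := by linarith
  have hv0 : 0 < v := by linarith
  have hw0 : 0 < w := lt_trans (div_pos (mul_pos hn0 hv0) (by linarith)) hcon
  rw [div_lt_iff₀ (by linarith)] at hcon
  obtain ⟨η, h1, h2⟩ := exists_between (show 1 / w < (1 - 1 / v) / (2 * n - 2) by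
    rw [one_sub_div hv0.ne', div_div, div_lt_div_iff₀ hw0 (by positivity)]
    linarith)
  have hη0 : 0 < η := (by positivity : 0 < 1 / w).trans h1
  rw [lt_div_iff₀ hn0] at h2
  have hη := eventually_simulSolvable_of_polySolvable (n := 2 * n - 1) (by omega) hζ hv hη0
    (by
      rw [Nat.cast_sub (by omega)]
      push_cast
      rwa [show (2 * (n : ℝ) - 1 - 1) = 2 * n - 2 by ring]) hvs
  have := simulExponent_mul_polyExponent_le_one hζ (by omega) hw0 hw hη
  rw [div_lt_iff₀ hw0] at h1
  linarith

theorem lambdaHat_le_iff {a : EReal} : lambdaHat n ζ ≤ a ↔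
    ∀ η : ℝ, (∀ᶠ X in atTop, SimulSolvable n ζ η X) → (η : EReal) ≤ a := by
  simp only [lambdaHat, sSup_le_iff, Set.forall_mem_image, Set.mem_ofPred_eq, eventually_atTop]

theorem wHat_le_iff {a : EReal} : wHat n ζ ≤ a ↔
    ∀ η : ℝ, (∀ᶠ X in atTop, PolySolvable n ζ η X) → (η : EReal) ≤ a := by
  simp only [wHat, sSup_le_iff, Set.forall_mem_image, Set.mem_ofPred_eq, eventually_atTop]

theorem lambdaHat_two_mul_sub_one_le (hn : 2 ≤ n) (hζ : Transcendental ℚ ζ) :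
    lambdaHat (2 * n - 1) ζ ≤ (1 - lambdaHat n ζ) / (((n : ℝ) - 1 : ℝ) : EReal) := by
  have hn2 : (2 : ℝ) ≤ n := by exact_mod_cast hn
  rw [lambdaHat_le_iff]
  intro η hη
  have h : lambdaHat n ζ ≤ ((1 - (n - 1) * η : ℝ) : EReal) := by
    rw [lambdaHat_le_iff]
    intro μ hμ
    have := mul_simulExponent_add_simulExponent_le_one hn hζ hμ hη
    exact EReal.coe_le_coe_iff.mpr (by linarith)
  rw [EReal.le_div_iff_mul_le (EReal.coe_pos.mpr (by linarith)) (EReal.coe_ne_top _)]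
  calc (η : EReal) * (((n : ℝ) - 1 : ℝ) : EReal) = 1 - ((1 - (n - 1) * η : ℝ) : EReal) := by
        rw [← EReal.coe_one, ← EReal.coe_mul, ← EReal.coe_sub]
        congr 1
        ring
    _ ≤ _ := EReal.sub_le_sub le_rfl h

/-- The Dirichlet exponent `1 / (2 * n)` in dimension `2 * n - 1` caps every polynomial exponent at
`2 * n`. Finiteness lets the final quotient be handled over the reals. -/
theorem wHat_ne_top (hn : 1 ≤ n) (hζ : Transcendental ℚ ζ) : wHat n ζ ≠ ⊤ := by
  have h : wHat n ζ ≤ ((((2 * n - 1 : ℕ) : ℝ) + 1 : ℝ) : EReal) := by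
    rw [wHat_le_iff]
    intro w hw
    refine EReal.coe_le_coe_iff.mpr ?_
    by_cases hw0 : 0 < w
    · have := simulExponent_mul_polyExponent_le_one hζ hn hw0 hw
        (eventually_simulSolvable_one_div (2 * n - 1) ζ)
      rwa [one_div_mul_eq_div, div_le_one (by positivity)] at this
    · exact (not_lt.mp hw0).trans (by positivity)
  exact (h.trans_lt (EReal.coe_lt_top _)).ne

theorem wHat_two_mul_sub_one_le (hn : 2 ≤ n) (hζ : Transcendental ℚ ζ)
    (h : ((2 * (n : ℝ) - 2 : ℝ) : EReal) < wHat n ζ) :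
    wHat (2 * n - 1) ζ ≤ wHat n ζ / (wHat n ζ - ((2 * (n : ℝ) - 2 : ℝ) : EReal)) := by
  have hn2 : (2 : ℝ) ≤ n := by exact_mod_cast hn
  obtain ⟨W, hW⟩ : ∃ W : ℝ, (W : EReal) = wHat n ζ :=
    ⟨_, EReal.coe_toReal (wHat_ne_top (by omega) hζ) (bot_le.trans_lt h).ne'⟩
  have hle : ∀ a : ℝ, (∀ w : ℝ, (∀ᶠ X in atTop, PolySolvable n ζ w X) → w ≤ a) → W ≤ a := by
    intro a ha
    rw [← EReal.coe_le_coe_iff, hW, wHat_le_iff]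
    exact fun w hw => EReal.coe_le_coe_iff.mpr (ha w hw)
  rw [← hW, EReal.coe_lt_coe_iff] at h
  rw [← hW, ← EReal.coe_sub, ← EReal.coe_div, wHat_le_iff]
  intro v hv
  rw [EReal.coe_le_coe_iff, le_div_iff₀ (by linarith)]
  by_cases hv1 : 1 < v
  · have := hle _ fun w hw => polyExponent_le_of_polyExponent hn hζ hv1 hw hv
    rw [le_div_iff₀ (by linarith)] at this
    linarith
  -- For `v ≤ 1` nothing is needed: the asserted upper bound exceeds 1.
  · nlinarith

end Exponents

theorem mainTheorem7 (ζ : ℝ) (hζ : Transcendental ℚ ζ) :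
    (∀ n : ℕ, 2 ≤ n →
      lambdaHat (2 * n - 1) ζ ≤ (1 - lambdaHat n ζ) / (((n : ℝ) - 1 : ℝ) : EReal)) ∧
    lambdaHat 2 ζ + lambdaHat 3 ζ ≤ 1 ∧
    (∀ n : ℕ, 2 ≤ n → ((2 * (n : ℝ) - 2 : ℝ) : EReal) < wHat n ζ →
      wHat (2 * n - 1) ζ ≤ wHat n ζ / (wHat n ζ - ((2 * (n : ℝ) - 2 : ℝ) : EReal))) := by
  refine ⟨fun n hn => lambdaHat_two_mul_sub_one_le hn hζ, ?_,
    fun n hn h => wHat_two_mul_sub_one_le hn hζ h⟩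
  have h := lambdaHat_two_mul_sub_one_le le_rfl hζ
  have e : (((2 : ℕ) : ℝ) - 1 : ℝ) = 1 := by norm_num
  rw [e, EReal.coe_one, div_one] at h
  rw [add_comm]
  exact EReal.add_le_of_le_sub h
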